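/- Let $\mathbb K=\mathbb R$ or $\mathbb C$, let $\chi_0,\chi_\infty\in\mathbb K$ be arbitrary and let $t_0\in\mathbb K$, $t_0\neq 0$. Consider $\mathbb K$-valued functions $\lambda$ that are analytic at $t_0$, satisfy $\lambda(t_0)=0$, and in some punctured neighbourhood of $t_0$ are non-zero and satisfy the third Painlevé equation (P3$'$) $$\ddot\lambda=\frac{\dot\lambda^2}{\lambda}-\frac{\dot\lambda}{t}-\frac{\chi_\infty\lambda^2}{t^2}+\frac{\lambda^3}{t^2}+\frac{\chi_0}{t}-\frac1\lambda .$$ These solutions form two families, distinguished by the value $\dot\lambda(t_0)$, which is $+1$ for one family and $-1$ for the other: every such solution has $\dot\lambda(t_0)\in\{+1,-1\}$. Every such solution satisfies $\ddot\lambda(t_0)=(\dot\lambda(t_0)-\chi_0)/t_0$, so the second derivative at $t_0$ is common to all members of a family. Within each family a solution is identified by its third derivative at $t_0$, which can be arbitrary: for each $\sigma\in\{+1,-1\}$ and each $c\in\mathbb K$ there is such a solution with $\dot\lambda(t_0)=\sigma$ and $\dddot\lambda(t_0)=c$, and any two such solutions with the same values of $\dot\lambda(t_0)$ and $\dddot\lambda(t_0)$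 coincide in a neighbourhood of $t_0$. -/

import Mathlib

open Filter Topology

/-- The third Painlevé equation (P3') with parameters `χ₀`, `χinf`, for the unknown function `u`,
at the point `t`. The equation has the denominators `t` and `u t`; it is meaningful,
and is said to hold, only where both are nonzero. -/
def PainleveThreePrimeAt {𝕜 : Type*} [RCLike 𝕜] (χ₀ χinf : 𝕜) (u : 𝕜 → 𝕜) (t : 𝕜) : Prop :=
  t ≠ 0 ∧ u t ≠ 0 ∧
    iteratedDeriv 2 u t =
      (deriv u t) ^ 2 / u t - deriv u t / t - χinf * (u t) ^ 2 / t ^ 2 + (u t) ^ 3 / t ^ 2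
        + χ₀ / t - 1 / u t

/-- `u` is analytic at `t₀`, vanishes there, and solves (P3') near `t₀`. At `t₀` itself the right
hand side is of the form `0 / 0`, so the equation is required on a punctured neighbourhood. -/
structure IsVanishingPainleveThreePrimeSolution {𝕜 : Type*} [RCLike 𝕜]
    (χ₀ χinf t₀ : 𝕜) (u : 𝕜 → 𝕜) : Prop where
  analyticAt : AnalyticAt 𝕜 u t₀
  vanishes : u t₀ = 0
  equation : ∀ᶠ t in 𝓝[≠] t₀, PainleveThreePrimeAt χ₀ χinf u t

/-!
Let `u` be a solution vanishing at `t₀`. Clearing denominators and letting `t → t₀` in the equation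
and in its first derivative gives `u'(t₀)² = 1` and `t₀ u''(t₀) = u'(t₀) - χ₀`. Writing
`σ = u'(t₀)` and `μ = 1 - σ χ₀`, these two relations say exactly that `t u' - σ t - μ u` vanishes to
second order at `t₀`, so that `w = (t u' - σ t - μ u) / u²` is analytic there. In the unknowns
`(u, w)` the Painlevé equation becomes the polynomial system

  `t u' = σ t + μ u + u² w`,  `t w' = u - u w² - μ w - χinf`,

which is regular at `t₀ ≠ 0` (`IsVanishingPainleveThreePrimeSolution.exists_regularSystem`), and
conversely every solution of this system with `u(t₀) = 0` and `σ² = 1` solves the Painlevé equation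
(`isVanishing_of_regularSystem`). Differentiating the first equation twice gives
`t₀ u'''(t₀) = (μ - 2) u''(t₀) + 2 w(t₀)`, so that prescribing the third derivative amounts to
prescribing `w(t₀)` (`deriv_and_third_deriv_of_regularSystem`).

It remains to solve the initial value problem for the regular system among analytic functions over
`ℝ` or `ℂ`. Existence (`exists_analytic_regularSystem`) holds because the formal solution converges:
for a small radius `r` the partial sums of `∑ ‖aₙ‖ rⁿ` stay bounded, by induction, since those of a
product are at most the product of the partial sums. Uniqueness (`regularSystem_unique`) compares
orders of vanishing at `t₀`: the difference of two solutions satisfies a linear system, hence its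
derivative vanishes to at least the same order as the difference, which forces the order to be
infinite.
-/

/-! ### Evaluation of power series -/

section PowerSeriesEvaluation

open PowerSeries Finset

variable {𝕜 : Type*} [RCLike 𝕜] {P Q : 𝕜⟦X⟧} {s : 𝕜}

/-- The sum of a formal power series at `s`, meaningful where the series is summable. -/
noncomputable def seriesSum (P : 𝕜⟦X⟧) (s : 𝕜) : 𝕜 := ∑' n, coeff n P * s ^ n

/-- Absolute convergence of a formal power series at `s`. -/
def AbsConvergesAt (P : 𝕜⟦X⟧) (s : 𝕜) : Prop := Summable fun n => ‖coeff n P * s ^ n‖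

lemma AbsConvergesAt.summable (h : AbsConvergesAt P s) : Summable fun n => coeff n P * s ^ n :=
  Summable.of_norm h

lemma coeff_mul_mul_pow (P Q : 𝕜⟦X⟧) (s : 𝕜) (n : ℕ) :
    coeff n (P * Q) * s ^ n =
      ∑ p ∈ antidiagonal n, (coeff p.1 P * s ^ p.1) * (coeff p.2 Q * s ^ p.2) := by
  rw [coeff_mul, sum_mul]
  refine sum_congr rfl fun p hp => ?_
  rw [← mem_antidiagonal.mp hp, pow_add]
  ring

lemma AbsConvergesAt.mul (hP : AbsConvergesAt P s) (hQ : AbsConvergesAt Q s) :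
    AbsConvergesAt (P * Q) s := by
  have := summable_norm_sum_mul_antidiagonal_of_summable_norm hP hQ
  simpa only [AbsConvergesAt, coeff_mul_mul_pow] using this

lemma AbsConvergesAt.add (hP : AbsConvergesAt P s) (hQ : AbsConvergesAt Q s) :
    AbsConvergesAt (P + Q) s := by
  refine Summable.of_nonneg_of_le (fun _ => norm_nonneg _) (fun n => ?_) (Summable.add hP hQ)
  rw [map_add, add_mul]
  exact norm_add_le _ _

lemma absConvergesAt_C (a : 𝕜) : AbsConvergesAt (C a) s := by
  refine summable_of_ne_finset_zero (s := {0}) fun n hn => ?_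
  simp [coeff_C, mem_singleton.not.mp hn]

lemma absConvergesAt_X : AbsConvergesAt (X : 𝕜⟦X⟧) s := by
  refine summable_of_ne_finset_zero (s := {1}) fun n hn => ?_
  simp [coeff_X, mem_singleton.not.mp hn]

lemma seriesSum_mul (hP : AbsConvergesAt P s) (hQ : AbsConvergesAt Q s) :
    seriesSum (P * Q) s = seriesSum P s * seriesSum Q s := by
  simp only [seriesSum, coeff_mul_mul_pow]
  exact (tsum_mul_tsum_eq_tsum_sum_antidiagonal_of_summable_norm hP hQ).symm

lemma seriesSum_add (hP : AbsConvergesAt P s) (hQ : AbsConvergesAt Q s) :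
    seriesSum (P + Q) s = seriesSum P s + seriesSum Q s := by
  simp only [seriesSum, map_add, add_mul]
  exact hP.summable.tsum_add hQ.summable

lemma seriesSum_C (a : 𝕜) : seriesSum (C a) s = a := by
  rw [seriesSum, tsum_eq_single 0 fun n hn => by simp [coeff_C, hn]]
  simp

lemma seriesSum_X : seriesSum (X : 𝕜⟦X⟧) s = s := by
  rw [seriesSum, tsum_eq_single 1 fun n hn => by simp [coeff_X, hn]]
  simp

lemma seriesSum_zero (P : 𝕜⟦X⟧) : seriesSum P 0 = constantCoeff P := by
  rw [seriesSum, tsum_eq_single 0 fun n hn => by simp [hn]]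
  simp

lemma AbsConvergesAt.hasFPowerSeriesOnBall {r : NNReal} (hr : 0 < r)
    (h : AbsConvergesAt P ((r : ℝ) : 𝕜)) :
    HasFPowerSeriesOnBall (seriesSum P)
      (FormalMultilinearSeries.ofScalars 𝕜 fun n => coeff n P) 0 r := by
  have hrad : (r : ENNReal) ≤
      (FormalMultilinearSeries.ofScalars 𝕜 fun n => coeff n P).radius := by
    refine FormalMultilinearSeries.le_radius_of_summable _ ?_
    refine h.congr fun n => ?_
    simp
  have hsum : seriesSum P = (FormalMultilinearSeries.ofScalars 𝕜 fun n => coeff n P).sum := by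
    ext s
    simp [seriesSum, FormalMultilinearSeries.sum, mul_comm]
  rw [hsum]
  exact (FormalMultilinearSeries.hasFPowerSeriesOnBall _
    (lt_of_lt_of_le (by exact_mod_cast hr) hrad)).mono (by exact_mod_cast hr) hrad

/-- A power series that converges absolutely at radius `r` may be differentiated term by term
inside the disc of radius `r`. -/
lemma AbsConvergesAt.derivative {r : NNReal} (hr : 0 < r)
    (h : AbsConvergesAt P ((r : ℝ) : 𝕜)) (hs : ‖s‖ < r) :
    AbsConvergesAt (d⁄dX 𝕜 P) s ∧ HasDerivAt (seriesSum P) (seriesSum (d⁄dX 𝕜 P) s) s := by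
  have hf := h.hasFPowerSeriesOnBall hr
  have hs' : s ∈ Metric.eball (0 : 𝕜) r := by
    simpa [Metric.mem_eball, edist_zero_right, ← ofReal_norm, ENNReal.ofReal_lt_coe_iff] using hs
  have h1 := (hf.fderiv.hasSum hs').mapL (ContinuousLinearMap.apply 𝕜 𝕜 (1 : 𝕜))
  have h2 : HasSum (fun n => coeff n (d⁄dX 𝕜 P) * s ^ n) (deriv (seriesSum P) s) := by
    have h3 : deriv (seriesSum P) s = (ContinuousLinearMap.apply 𝕜 𝕜 (1 : 𝕜))
        (fderiv 𝕜 (seriesSum P) (0 + s)) := by simp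
    rw [h3]
    refine h1.congr_fun ?_
    intro n
    rw [FormalMultilinearSeries.apply_eq_pow_smul_coeff, map_smul,
      ContinuousLinearMap.apply_apply, FormalMultilinearSeries.derivSeries_coeff_one,
      FormalMultilinearSeries.coeff_ofScalars, coeff_derivative]
    simp
    ring
  refine ⟨summable_norm_iff.mpr h2.summable, ?_⟩
  rw [seriesSum, h2.tsum_eq]
  have : AnalyticAt 𝕜 (seriesSum P) s := hf.analyticAt_of_mem hs'
  exact this.differentiableAt.hasDerivAt

end PowerSeriesEvaluation

/-! ### A regular system with a power series solution -/

section RegularSystem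

open PowerSeries Finset

/-- A sequence can be defined by a recursion in which the next term is an arbitrary function of
the terms already constructed. -/
lemma exists_seq_of_causal_recursion {α : Type*} (a : α) (Φ : ℕ → (ℕ → α) → α)
    (hΦ : ∀ n c c', (∀ i ≤ n, c i = c' i) → Φ n c = Φ n c') :
    ∃ c : ℕ → α, c 0 = a ∧ ∀ n, c (n + 1) = Φ n c := by
  -- `A n` is correct up to the index `n`.
  let A : ℕ → ℕ → α := Nat.rec (fun _ => a) fun n c => Function.update c (n + 1) (Φ n c)
  have hA : ∀ n i, i ≤ n → A n i = A i i := by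
    intro n
    induction n with
    | zero => intro i hi; rw [Nat.le_zero.mp hi]
    | succ n ih =>
      intro i hi
      rcases Nat.lt_or_eq_of_le hi with h | rfl
      · rw [← ih i (by omega)]
        exact Function.update_of_ne (by omega) _ _
      · rfl
  refine ⟨fun n => A n n, rfl, fun n => ?_⟩
  have : A (n + 1) (n + 1) = Φ n (A n) := Function.update_self _ _ _
  simp only [this]
  exact hΦ _ _ _ fun i hi => hA n i hi

variable {𝕜 : Type*} [RCLike 𝕜]

lemma coeff_mul_congr {P P' Q Q' : 𝕜⟦X⟧} {n : ℕ} (hP : ∀ i ≤ n, coeff i P = coeff i P')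
    (hQ : ∀ i ≤ n, coeff i Q = coeff i Q') : ∀ i ≤ n, coeff i (P * Q) = coeff i (P' * Q') := by
  intro i hi
  rw [coeff_mul, coeff_mul]
  refine sum_congr rfl fun p hp => ?_
  have := mem_antidiagonal.mp hp
  rw [hP _ (by omega), hQ _ (by omega)]

lemma coeff_C_add_X_mul_derivative (a : 𝕜) (P : 𝕜⟦X⟧) (n : ℕ) :
    coeff n ((C a + X) * d⁄dX 𝕜 P) = a * ((n + 1) * coeff (n + 1) P) + n * coeff n P := by
  rw [add_mul, map_add, coeff_C_mul, coeff_derivative]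
  cases n with
  | zero => simp
  | succ n => rw [coeff_succ_X_mul, coeff_derivative]; push_cast; ring

/-- The system
`t l' = σ t + μ l + l² w`, `t w' = l - l w² - μ w - χ`
has a formal solution in powers of `t - t₀` with arbitrary initial values. -/
lemma exists_formal_solution (σ μ χ l₀ w₀ : 𝕜) {t₀ : 𝕜} (ht₀ : t₀ ≠ 0) :
    ∃ L W : 𝕜⟦X⟧, constantCoeff L = l₀ ∧ constantCoeff W = w₀ ∧
      (C t₀ + X) * d⁄dX 𝕜 L = C σ * (C t₀ + X) + C μ * L + L * L * W ∧
      (C t₀ + X) * d⁄dX 𝕜 W = L + C (-1) * (L * (W * W)) + C (-μ) * W + C (-χ) := by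
  let F : 𝕜⟦X⟧ → 𝕜⟦X⟧ → 𝕜⟦X⟧ := fun L W => C σ * (C t₀ + X) + C μ * L + L * L * W
  let G : 𝕜⟦X⟧ → 𝕜⟦X⟧ → 𝕜⟦X⟧ := fun L W =>
    L + C (-1) * (L * (W * W)) + C (-μ) * W + C (-χ)
  let S₁ : (ℕ → 𝕜 × 𝕜) → 𝕜⟦X⟧ := fun c => PowerSeries.mk fun i => (c i).1
  let S₂ : (ℕ → 𝕜 × 𝕜) → 𝕜⟦X⟧ := fun c => PowerSeries.mk fun i => (c i).2
  obtain ⟨c, hc0, hc⟩ := exists_seq_of_causal_recursion (l₀, w₀)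
    (fun n c => ((coeff n (F (S₁ c) (S₂ c)) - n * (c n).1) / (t₀ * (n + 1)),
      (coeff n (G (S₁ c) (S₂ c)) - n * (c n).2) / (t₀ * (n + 1)))) (by
    intro n c c' h
    have h1 : ∀ i ≤ n, coeff i (S₁ c) = coeff i (S₁ c') := fun i hi => by
      simp [S₁, h i hi]
    have h2 : ∀ i ≤ n, coeff i (S₂ c) = coeff i (S₂ c') := fun i hi => by
      simp [S₂, h i hi]
    have hF : coeff n (F (S₁ c) (S₂ c)) = coeff n (F (S₁ c') (S₂ c')) := by
      simp only [F, map_add, coeff_C_mul, h1 n le_rfl,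
        coeff_mul_congr (coeff_mul_congr h1 h1) h2 n le_rfl]
    have hG : coeff n (G (S₁ c) (S₂ c)) = coeff n (G (S₁ c') (S₂ c')) := by
      simp only [G, map_add, coeff_C_mul, h1 n le_rfl, h2 n le_rfl,
        coeff_mul_congr h1 (coeff_mul_congr h2 h2) n le_rfl]
    simp only [hF, hG, h n le_rfl])
  have hn : ∀ n : ℕ, (n : 𝕜) + 1 ≠ 0 := fun n => by exact_mod_cast n.succ_ne_zero
  refine ⟨S₁ c, S₂ c, ?_, ?_, ?_, ?_⟩
  · simp [S₁, ← coeff_zero_eq_constantCoeff_apply, hc0]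
  · simp [S₂, ← coeff_zero_eq_constantCoeff_apply, hc0]
  · ext n
    rw [coeff_C_add_X_mul_derivative]
    change t₀ * ((n + 1) * coeff (n + 1) (S₁ c)) + n * coeff n (S₁ c) = coeff n (F (S₁ c) (S₂ c))
    have := hn n
    simp only [S₁, coeff_mk, hc n]
    field_simp
    ring
  · ext n
    rw [coeff_C_add_X_mul_derivative]
    change t₀ * ((n + 1) * coeff (n + 1) (S₂ c)) + n * coeff n (S₂ c) = coeff n (G (S₁ c) (S₂ c))
    have := hn n
    simp only [S₂, coeff_mk, hc n]
    field_simp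
    ring

/-- The partial sums of the majorant `∑ ‖aₙ‖ rⁿ` of a power series `∑ aₙ Xⁿ`. -/
noncomputable def majorantSum (r : ℝ) (N : ℕ) (P : 𝕜⟦X⟧) : ℝ :=
  ∑ n ∈ range N, ‖coeff n P‖ * r ^ n

section Majorant

variable {r : ℝ} {N : ℕ} {P Q : 𝕜⟦X⟧}

lemma majorantSum_nonneg (hr : 0 ≤ r) : 0 ≤ majorantSum r N P :=
  sum_nonneg fun _ _ => by positivity

lemma majorantSum_add_le (hr : 0 ≤ r) :
    majorantSum r N (P + Q) ≤ majorantSum r N P + majorantSum r N Q := by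
  rw [majorantSum, majorantSum, majorantSum, ← sum_add_distrib]
  refine sum_le_sum fun n _ => ?_
  rw [← add_mul, map_add]
  gcongr
  exact norm_add_le _ _

lemma majorantSum_C_mul (a : 𝕜) : majorantSum r N (C a * P) = ‖a‖ * majorantSum r N P := by
  simp [majorantSum, mul_sum, mul_assoc]

lemma majorantSum_C_le (a : 𝕜) : majorantSum r N (C a) ≤ ‖a‖ := by
  cases N with
  | zero => simp [majorantSum]
  | succ N =>
    rw [majorantSum, sum_range_succ', sum_eq_zero fun n _ => by simp]
    simp

lemma majorantSum_X_le (hr : 0 ≤ r) : majorantSum r N (X : 𝕜⟦X⟧) ≤ r := by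
  have : ∀ n ∈ range N, ‖coeff n (X : 𝕜⟦X⟧)‖ * r ^ n = if n = 1 then r else 0 := by
    intro n _
    rw [coeff_X]
    split_ifs with h <;> simp [h]
  rw [majorantSum, sum_congr rfl this, sum_ite_eq']
  split_ifs <;> simp [hr]

lemma majorantSum_mul_le (hr : 0 ≤ r) :
    majorantSum r N (P * Q) ≤ majorantSum r N P * majorantSum r N Q := by
  have key : ∀ n, ‖coeff n (P * Q)‖ * r ^ n ≤
      ∑ p ∈ antidiagonal n, (‖coeff p.1 P‖ * r ^ p.1) * (‖coeff p.2 Q‖ * r ^ p.2) := by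
    intro n
    rw [coeff_mul]
    refine (mul_le_mul_of_nonneg_right (norm_sum_le _ _) (by positivity)).trans_eq ?_
    rw [sum_mul]
    refine sum_congr rfl fun p hp => ?_
    rw [← mem_antidiagonal.mp hp, pow_add, norm_mul]
    ring
  refine (sum_le_sum fun n _ => key n).trans ?_
  rw [majorantSum, majorantSum, sum_mul_sum, ← sum_product', sum_sigma']
  have inj : Set.InjOn (fun x : (_ : ℕ) × ℕ × ℕ => x.2)
      ((range N).sigma fun n => antidiagonal n) := by
    rintro ⟨m, p⟩ hm ⟨n, q⟩ hn (rfl : p = q)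
    simp only [coe_sigma, Set.mem_sigma_iff, mem_coe, HasAntidiagonal.mem_antidiagonal] at hm hn
    rw [← hm.2, ← hn.2]
  rw [← sum_image (f := fun p : ℕ × ℕ =>
    (‖coeff p.1 P‖ * r ^ p.1) * (‖coeff p.2 Q‖ * r ^ p.2)) inj]
  refine sum_le_sum_of_subset_of_nonneg ?_ fun p _ _ => by positivity
  intro p hp
  simp only [mem_image, mem_sigma, mem_range, HasAntidiagonal.mem_antidiagonal, Sigma.exists] at hp
  obtain ⟨n, q, ⟨hn, hq⟩, rfl⟩ := hp
  simp only [mem_product, mem_range]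
  omega

/-- One step of the majorant estimate for `(t₀ + X) P' = Q`: the division by the index gained by
integration is not needed. -/
lemma majorantSum_succ_le {t₀ : 𝕜} (ht₀ : t₀ ≠ 0) (hr : 0 ≤ r)
    (h : (C t₀ + X) * d⁄dX 𝕜 P = Q) :
    majorantSum r (N + 1) P ≤
      ‖constantCoeff P‖ + r / ‖t₀‖ * (majorantSum r N Q + majorantSum r N P) := by
  have ht : 0 < ‖t₀‖ := norm_pos_iff.mpr ht₀
  have key : ∀ n, ‖coeff (n + 1) P‖ ≤ (‖coeff n Q‖ + ‖coeff n P‖) / ‖t₀‖ := by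
    intro n
    have h1 := coeff_C_add_X_mul_derivative t₀ P n
    rw [h] at h1
    have hn : (0 : ℝ) < n + 1 := by positivity
    have h2 : ‖t₀‖ * ((n + 1) * ‖coeff (n + 1) P‖) ≤ ‖coeff n Q‖ + n * ‖coeff n P‖ := by
      have h3 : t₀ * ((n + 1) * coeff (n + 1) P) = coeff n Q - n * coeff n P := by
        rw [h1]; ring
      have h4 : ‖(n : 𝕜) + 1‖ = n + 1 := by exact_mod_cast RCLike.norm_natCast (K := 𝕜) (n + 1)
      have := norm_sub_le (coeff n Q) (n * coeff n P)
      rwa [← h3, norm_mul, norm_mul, norm_mul, h4, RCLike.norm_natCast] at this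
    rw [le_div_iff₀ ht]
    refine le_of_mul_le_mul_left ?_ hn
    nlinarith [mul_nonneg n.cast_nonneg (norm_nonneg (coeff n Q)), norm_nonneg (coeff n P)]
  rw [majorantSum, sum_range_succ', majorantSum, majorantSum, ← sum_add_distrib, mul_sum,
    add_comm]
  refine add_le_add (by simp) (sum_le_sum fun n _ => ?_)
  calc ‖coeff (n + 1) P‖ * r ^ (n + 1)
      ≤ (‖coeff n Q‖ + ‖coeff n P‖) / ‖t₀‖ * r ^ (n + 1) := by gcongr; exact key n
    _ = _ := by rw [pow_succ]; ring

end Majorant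

/-- A formal solution of the system of `exists_formal_solution` converges. -/
lemma exists_absConvergesAt_of_formal_solution {σ μ χ t₀ : 𝕜} (ht₀ : t₀ ≠ 0) {L W : 𝕜⟦X⟧}
    (hL : (C t₀ + X) * d⁄dX 𝕜 L = C σ * (C t₀ + X) + C μ * L + L * L * W)
    (hW : (C t₀ + X) * d⁄dX 𝕜 W = L + C (-1) * (L * (W * W)) + C (-μ) * W + C (-χ)) :
    ∃ r : NNReal, 0 < r ∧ AbsConvergesAt L ((r : ℝ) : 𝕜) ∧ AbsConvergesAt W ((r : ℝ) : 𝕜) := by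
  have ht : 0 < ‖t₀‖ := norm_pos_iff.mpr ht₀
  -- `M` bounds all partial sums, and `K` bounds the right-hand sides once `M` does.
  set M : ℝ := ‖constantCoeff L‖ + ‖constantCoeff W‖ + 1 with hM
  have hM0 : 0 < M := by positivity
  set K : ℝ := ‖σ‖ * (‖t₀‖ + 1) + ‖μ‖ * M + M * M * M + M + ‖χ‖ with hK
  have hK0 : 0 < K := by positivity
  set r : ℝ := ‖t₀‖ / (K + M + ‖t₀‖) with hr
  have hr0 : 0 < r := by positivity
  have hr1 : r ≤ 1 := by rw [hr, div_le_one (by positivity)]; linarith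
  have hrK : r / ‖t₀‖ * (K + M) ≤ 1 := by
    rw [hr, div_div_cancel_left' ht.ne', inv_mul_le_iff₀ (by positivity)]; linarith
  have bound : ∀ N, majorantSum r N L ≤ M ∧ majorantSum r N W ≤ M := by
    intro N
    induction N with
    | zero => simp [majorantSum, hM0.le]
    | succ N ih =>
      obtain ⟨hl, hw⟩ := ih
      have hl0 : 0 ≤ majorantSum r N L := majorantSum_nonneg hr0.le
      have hw0 : 0 ≤ majorantSum r N W := majorantSum_nonneg hr0.le
      have hF : majorantSum r N (C σ * (C t₀ + X) + C μ * L + L * L * W) ≤ K := by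
        have h1 : majorantSum r N (C t₀ + X) ≤ ‖t₀‖ + 1 :=
          (majorantSum_add_le hr0.le).trans (add_le_add (majorantSum_C_le _)
            ((majorantSum_X_le hr0.le).trans hr1))
        have h2 : majorantSum r N (L * L * W) ≤ M * M * M := by
          refine (majorantSum_mul_le hr0.le).trans ?_
          gcongr
          refine (majorantSum_mul_le hr0.le).trans ?_
          gcongr
        have h3 := mul_le_mul_of_nonneg_left h1 (norm_nonneg σ)
        have h4 := mul_le_mul_of_nonneg_left hl (norm_nonneg μ)
        refine (majorantSum_add_le hr0.le).trans ?_
        refine (add_le_add (majorantSum_add_le hr0.le) h2).trans ?_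
        rw [majorantSum_C_mul, majorantSum_C_mul]
        linarith [norm_nonneg χ]
      have hG : majorantSum r N (L + C (-1) * (L * (W * W)) + C (-μ) * W + C (-χ)) ≤ K := by
        have h2 : majorantSum r N (L * (W * W)) ≤ M * M * M := by
          have hww := (majorantSum_mul_le hr0.le).trans (mul_le_mul hw hw hw0 hM0.le)
          rw [mul_assoc]
          exact (majorantSum_mul_le hr0.le).trans
            (mul_le_mul hl hww (majorantSum_nonneg hr0.le) hM0.le)
        have h3 : 0 ≤ ‖σ‖ * (‖t₀‖ + 1) := by positivity
        have h4 := mul_le_mul_of_nonneg_left hw (norm_nonneg μ)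
        refine (majorantSum_add_le hr0.le).trans ?_
        refine (add_le_add (majorantSum_add_le hr0.le) (majorantSum_C_le _)).trans ?_
        refine (add_le_add_left (add_le_add_left (majorantSum_add_le hr0.le) _) _).trans ?_
        rw [majorantSum_C_mul, majorantSum_C_mul, norm_neg, norm_neg, norm_neg, norm_one, one_mul]
        linarith
      have step : ∀ {P Q : 𝕜⟦X⟧}, (C t₀ + X) * d⁄dX 𝕜 P = Q → majorantSum r N Q ≤ K →
          majorantSum r N P ≤ M → ‖constantCoeff P‖ + 1 ≤ M → majorantSum r (N + 1) P ≤ M := by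
        intro P Q h hQ hP h0
        refine (majorantSum_succ_le ht₀ hr0.le h).trans (le_trans ?_ h0)
        gcongr
        refine le_trans ?_ hrK
        gcongr
      exact ⟨step hL hF hl (by linarith [norm_nonneg (constantCoeff W)]),
        step hW hG hw (by linarith [norm_nonneg (constantCoeff L)])⟩
  have conv : ∀ P : 𝕜⟦X⟧, (∀ N, majorantSum r N P ≤ M) → AbsConvergesAt P (r : 𝕜) := by
    intro P hP
    refine summable_of_sum_range_le (c := M) (fun _ => norm_nonneg _) fun N => ?_
    simpa [majorantSum, abs_of_pos hr0] using hP N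
  exact ⟨⟨r, hr0.le⟩, hr0, conv L fun N => (bound N).1, conv W fun N => (bound N).2⟩

/-- The pair `(l, w)` satisfies at `t` the system `t l' = σ t + μ l + l² w`,
`t w' = l - l w² - μ w - χ`. -/
def RegularSystemAt (σ μ χ : 𝕜) (l w : 𝕜 → 𝕜) (t : 𝕜) : Prop :=
  t * deriv l t = σ * t + μ * l t + l t ^ 2 * w t ∧
    t * deriv w t = l t - l t * w t ^ 2 - μ * w t - χ

/-- The system has analytic solutions with arbitrary initial values. -/
theorem exists_analytic_regularSystem (σ μ χ l₀ w₀ : 𝕜) {t₀ : 𝕜} (ht₀ : t₀ ≠ 0) :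
    ∃ l w : 𝕜 → 𝕜, AnalyticAt 𝕜 l t₀ ∧ AnalyticAt 𝕜 w t₀ ∧ l t₀ = l₀ ∧ w t₀ = w₀ ∧
      ∀ᶠ t in 𝓝 t₀, RegularSystemAt σ μ χ l w t := by
  obtain ⟨L, W, hL0, hW0, hL, hW⟩ := exists_formal_solution σ μ χ l₀ w₀ ht₀
  obtain ⟨r, hr, hLr, hWr⟩ := exists_absConvergesAt_of_formal_solution ht₀ hL hW
  have conv : ∀ {P : 𝕜⟦X⟧}, AbsConvergesAt P ((r : ℝ) : 𝕜) → ∀ {s : 𝕜}, ‖s‖ < r →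
      AbsConvergesAt P s := by
    intro P h s hs
    refine Summable.of_nonneg_of_le (fun _ => norm_nonneg _) (fun n => ?_) h
    rw [norm_mul, norm_mul, norm_pow, norm_pow]
    gcongr
    simpa using hs.le
  have analytic : ∀ {P : 𝕜⟦X⟧}, AbsConvergesAt P ((r : ℝ) : 𝕜) →
      AnalyticAt 𝕜 (fun t => seriesSum P (t - t₀)) t₀ := by
    intro P h
    refine AnalyticAt.fun_comp (f := fun t => t - t₀) ?_ (by fun_prop)
    rw [sub_self]
    exact (h.hasFPowerSeriesOnBall hr).analyticAt
  refine ⟨fun t => seriesSum L (t - t₀), fun t => seriesSum W (t - t₀), analytic hLr, analytic hWr,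
    by simp [seriesSum_zero, hL0], by simp [seriesSum_zero, hW0], ?_⟩
  filter_upwards [Metric.ball_mem_nhds t₀ (NNReal.coe_pos.mpr hr)] with t htr
  set s := t - t₀ with hs
  have hsr : ‖s‖ < r := by simpa [dist_eq_norm] using htr
  have hts : t = t₀ + s := by rw [hs]; ring
  obtain ⟨hL', hLd⟩ := hLr.derivative hr hsr
  obtain ⟨hW', hWd⟩ := hWr.derivative hr hsr
  have hLs := conv hLr hsr
  have hWs := conv hWr hsr
  have hT : AbsConvergesAt (C t₀ + X) s := (absConvergesAt_C _).add absConvergesAt_X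
  have hTs : seriesSum (C t₀ + X) s = t := by
    rw [seriesSum_add (absConvergesAt_C _) absConvergesAt_X, seriesSum_C, seriesSum_X, hts]
  have dL : deriv (fun t => seriesSum L (t - t₀)) t = seriesSum (d⁄dX 𝕜 L) s :=
    (HasDerivAt.comp_sub_const t t₀ hLd).deriv
  have dW : deriv (fun t => seriesSum W (t - t₀)) t = seriesSum (d⁄dX 𝕜 W) s :=
    (HasDerivAt.comp_sub_const t t₀ hWd).deriv
  constructor
  · have := congrArg (fun P => seriesSum P s) hL
    rw [seriesSum_mul hT hL', seriesSum_add (((absConvergesAt_C _).mul hT).add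
      ((absConvergesAt_C _).mul hLs)) ((hLs.mul hLs).mul hWs), seriesSum_add
      ((absConvergesAt_C _).mul hT) ((absConvergesAt_C _).mul hLs), seriesSum_mul
      (absConvergesAt_C _) hT, seriesSum_mul (absConvergesAt_C _) hLs, seriesSum_mul
      (hLs.mul hLs) hWs, seriesSum_mul hLs hLs, seriesSum_C, seriesSum_C, hTs] at this
    rw [dL, this]
    ring
  · have := congrArg (fun P => seriesSum P s) hW
    have hLWW := hLs.mul (hWs.mul hWs)
    have c1 := (absConvergesAt_C (-1 : 𝕜)).mul hLWW
    have c2 := (absConvergesAt_C (-μ)).mul hWs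
    rw [seriesSum_mul hT hW', seriesSum_add ((hLs.add c1).add c2) (absConvergesAt_C _),
      seriesSum_add (hLs.add c1) c2, seriesSum_add hLs c1, seriesSum_mul (absConvergesAt_C _) hLWW,
      seriesSum_mul (absConvergesAt_C _) hWs, seriesSum_mul hLs (hWs.mul hWs),
      seriesSum_mul hWs hWs, seriesSum_C, seriesSum_C, seriesSum_C, hTs] at this
    rw [dW, this]
    ring

end RegularSystem

/-! ### Uniqueness for the regular system -/

section Uniqueness

variable {𝕜 : Type*} [RCLike 𝕜] {σ μ χ t₀ : 𝕜}

/-- A relation `t a' = A a + B b` forces the order of `a'` at `t₀ ≠ 0` to be at least that of `a`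
or that of `b`. -/
lemma le_analyticOrderAt_deriv_of_linear (ht₀ : t₀ ≠ 0) {a b A B : 𝕜 → 𝕜} {n : ℕ∞}
    (ha : AnalyticAt 𝕜 a t₀) (hb : AnalyticAt 𝕜 b t₀) (hA : AnalyticAt 𝕜 A t₀)
    (hB : AnalyticAt 𝕜 B t₀) (h : ∀ᶠ t in 𝓝 t₀, t * deriv a t = A t * a t + B t * b t)
    (hna : n ≤ analyticOrderAt a t₀) (hnb : n ≤ analyticOrderAt b t₀) :
    n ≤ analyticOrderAt (deriv a) t₀ := by
  have hid : analyticOrderAt (id : 𝕜 → 𝕜) t₀ = 0 :=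
    (analyticAt_id).analyticOrderAt_eq_zero.mpr ht₀
  have h1 : analyticOrderAt (deriv a) t₀ = analyticOrderAt (A * a + B * b) t₀ := by
    have h2 : id * deriv a =ᶠ[𝓝 t₀] A * a + B * b := h
    rw [← analyticOrderAt_congr h2, analyticOrderAt_mul analyticAt_id ha.deriv, hid,
      zero_add]
  rw [h1]
  refine le_trans (le_min ?_ ?_) le_analyticOrderAt_add
  · rw [analyticOrderAt_mul hA ha]; exact hna.trans le_add_self
  · rw [analyticOrderAt_mul hB hb]; exact hnb.trans le_add_self

/-- Two analytic solutions of the system with the same values at `t₀` agree near `t₀`. The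
differences `a`, `b` solve a linear system, so their derivatives vanish at `t₀` at least to the
order `min (ord a) (ord b)`; since differentiation lowers a positive finite order, this minimum
is infinite. -/
theorem regularSystem_unique (ht₀ : t₀ ≠ 0) {l w l' w' : 𝕜 → 𝕜}
    (hl : AnalyticAt 𝕜 l t₀) (hw : AnalyticAt 𝕜 w t₀)
    (hl' : AnalyticAt 𝕜 l' t₀) (hw' : AnalyticAt 𝕜 w' t₀)
    (h : ∀ᶠ t in 𝓝 t₀, RegularSystemAt σ μ χ l w t)
    (h' : ∀ᶠ t in 𝓝 t₀, RegularSystemAt σ μ χ l' w' t)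
    (hl0 : l t₀ = l' t₀) (hw0 : w t₀ = w' t₀) :
    l =ᶠ[𝓝 t₀] l' := by
  have ha : AnalyticAt 𝕜 (l - l') t₀ := hl.sub hl'
  have hb : AnalyticAt 𝕜 (w - w') t₀ := hw.sub hw'
  have hdl : ∀ᶠ t in 𝓝 t₀, deriv (l - l') t = deriv l t - deriv l' t := by
    filter_upwards [hl.eventually_analyticAt, hl'.eventually_analyticAt] with t h1 h2
    exact deriv_sub h1.differentiableAt h2.differentiableAt
  have hdw : ∀ᶠ t in 𝓝 t₀, deriv (w - w') t = deriv w t - deriv w' t := by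
    filter_upwards [hw.eventually_analyticAt, hw'.eventually_analyticAt] with t h1 h2
    exact deriv_sub h1.differentiableAt h2.differentiableAt
  have e1 : ∀ᶠ t in 𝓝 t₀, t * deriv (l - l') t =
      (μ + (l t + l' t) * w t) * (l - l') t + l' t ^ 2 * (w - w') t := by
    filter_upwards [h, h', hdl] with t h1 h2 h3
    rw [h3, mul_sub, h1.1, h2.1, Pi.sub_apply, Pi.sub_apply]
    ring
  have e2 : ∀ᶠ t in 𝓝 t₀, t * deriv (w - w') t =
      (-μ - l' t * (w t + w' t)) * (w - w') t + (1 - w t ^ 2) * (l - l') t := by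
    filter_upwards [h, h', hdw] with t h1 h2 h3
    rw [h3, mul_sub, h1.2, h2.2, Pi.sub_apply, Pi.sub_apply]
    ring
  set n := min (analyticOrderAt (l - l') t₀) (analyticOrderAt (w - w') t₀) with hn
  have o1 : n ≤ analyticOrderAt (deriv (l - l')) t₀ :=
    le_analyticOrderAt_deriv_of_linear ht₀ ha hb (by fun_prop) (by fun_prop) e1
      (min_le_left _ _) (min_le_right _ _)
  have o2 : n ≤ analyticOrderAt (deriv (w - w')) t₀ :=
    le_analyticOrderAt_deriv_of_linear ht₀ hb ha (by fun_prop) (by fun_prop) e2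
      (min_le_right _ _) (min_le_left _ _)
  have p1 : analyticOrderAt (deriv (l - l')) t₀ + 1 = analyticOrderAt (l - l') t₀ := by
    rw [ha.analyticOrderAt_deriv_add_one]; simp only [Pi.sub_apply, hl0, sub_self, sub_zero]; rfl
  have p2 : analyticOrderAt (deriv (w - w')) t₀ + 1 = analyticOrderAt (w - w') t₀ := by
    rw [hb.analyticOrderAt_deriv_add_one]; simp only [Pi.sub_apply, hw0, sub_self, sub_zero]; rfl
  have hn1 : n + 1 ≤ n := by
    conv_rhs => rw [hn, ← p1, ← p2]
    exact le_min (by gcongr) (by gcongr)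
  have hntop : n = ⊤ := by
    by_contra hne
    exact absurd hn1 (not_le.mpr ((ENat.lt_add_one_iff hne).mpr le_rfl))
  have hltop : analyticOrderAt (l - l') t₀ = ⊤ := top_le_iff.mp (hntop ▸ min_le_left _ _)
  filter_upwards [analyticOrderAt_eq_top.mp hltop] with t ht
  exact sub_eq_zero.mp ht

end Uniqueness

/-! ### The Painlevé equation and the regular system -/

section Painleve

variable {𝕜 : Type*} [RCLike 𝕜] {σ χ₀ χinf t₀ : 𝕜}

lemma eventually_hasDerivAt {f : 𝕜 → 𝕜} (hf : AnalyticAt 𝕜 f t₀) :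
    ∀ᶠ t in 𝓝 t₀, HasDerivAt f (deriv f t) t :=
  hf.eventually_analyticAt.mono fun _ h => h.differentiableAt.hasDerivAt

/-- The derivative of the first equation of the regular system. -/
lemma eventually_second_deriv {μ χ : 𝕜} {l w : 𝕜 → 𝕜} (hl : AnalyticAt 𝕜 l t₀)
    (hw : AnalyticAt 𝕜 w t₀) (h : ∀ᶠ t in 𝓝 t₀, RegularSystemAt σ μ χ l w t) :
    ∀ᶠ t in 𝓝 t₀, t * deriv (deriv l) t + deriv l t =
      σ + μ * deriv l t + (2 * l t * deriv l t * w t + l t ^ 2 * deriv w t) := by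
  have h1 : (fun t => t * deriv l t) =ᶠ[𝓝 t₀] fun t => σ * t + μ * l t + l t ^ 2 * w t :=
    h.mono fun t ht => ht.1
  filter_upwards [h1.deriv, eventually_hasDerivAt hl, eventually_hasDerivAt hw,
    eventually_hasDerivAt hl.deriv] with t ht dl dw ddl
  have e1 := ((hasDerivAt_id' t).mul ddl).deriv
  have e2 := ((((hasDerivAt_id' t).const_mul σ).add (dl.const_mul μ)).add
    ((dl.pow 2).mul dw)).deriv
  have e3 := e1.symm.trans (ht.trans e2)
  simp only [Pi.pow_apply] at e3
  norm_num at e3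
  linear_combination e3

/-- For a solution of the regular system with `l t₀ = 0`, the third derivative of `l` at `t₀` is an
invertible affine function of the free initial value `w t₀`. -/
lemma deriv_and_third_deriv_of_regularSystem {χ : 𝕜} (ht₀ : t₀ ≠ 0) {l w : 𝕜 → 𝕜}
    (hσ : σ ^ 2 = 1) (hl : AnalyticAt 𝕜 l t₀) (hw : AnalyticAt 𝕜 w t₀) (hl0 : l t₀ = 0)
    (h : ∀ᶠ t in 𝓝 t₀, RegularSystemAt σ (1 - σ * χ₀) χ l w t) :
    deriv l t₀ = σ ∧
      t₀ * iteratedDeriv 3 l t₀ = (-1 - σ * χ₀) * ((σ - χ₀) / t₀) + 2 * w t₀ := by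
  have h0 : deriv l t₀ = σ := by
    have := h.self_of_nhds.1
    rw [hl0] at this
    refine mul_left_cancel₀ ht₀ ?_
    linear_combination this
  have hE := eventually_second_deriv hl hw h
  have h2 : deriv (deriv l) t₀ = (σ - χ₀) / t₀ := by
    have := hE.self_of_nhds
    rw [hl0, h0] at this
    field_simp
    linear_combination this - χ₀ * hσ
  refine ⟨h0, ?_⟩
  have dl := hl.differentiableAt.hasDerivAt
  have ddl := hl.deriv.differentiableAt.hasDerivAt
  have dddl := hl.deriv.deriv.differentiableAt.hasDerivAt
  have dw := hw.differentiableAt.hasDerivAt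
  have ddw := hw.deriv.differentiableAt.hasDerivAt
  have hE' : (fun t => t * deriv (deriv l) t + deriv l t) =ᶠ[𝓝 t₀] fun t =>
      σ + (1 - σ * χ₀) * deriv l t + (2 * l t * deriv l t * w t + l t ^ 2 * deriv w t) := hE
  have e1 := (((hasDerivAt_id' t₀).mul dddl).add ddl).deriv
  have e2 := (((ddl.const_mul (1 - σ * χ₀)).const_add σ).add
    ((((dl.const_mul 2).mul ddl).mul dw).add ((dl.pow 2).mul ddw))).deriv
  have e3 := e1.symm.trans (hE'.deriv_eq.trans e2)
  have hit : iteratedDeriv 3 l t₀ = deriv (deriv (deriv l)) t₀ := by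
    simp [iteratedDeriv_succ, iteratedDeriv_zero]
  simp only [Pi.pow_apply, Pi.mul_apply, hl0, h0, h2] at e3
  norm_num at e3
  rw [hit]
  linear_combination e3 + 2 * w t₀ * hσ

/-- Solutions of the regular system with `l t₀ = 0` solve the Painlevé equation. -/
lemma isVanishing_of_regularSystem (ht₀ : t₀ ≠ 0) {l w : 𝕜 → 𝕜} (hσ : σ ^ 2 = 1)
    (hl : AnalyticAt 𝕜 l t₀) (hw : AnalyticAt 𝕜 w t₀) (hl0 : l t₀ = 0)
    (h : ∀ᶠ t in 𝓝 t₀, RegularSystemAt σ (1 - σ * χ₀) χinf l w t) :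
    IsVanishingPainleveThreePrimeSolution χ₀ χinf t₀ l := by
  refine ⟨hl, hl0, ?_⟩
  have h0 := (deriv_and_third_deriv_of_regularSystem ht₀ hσ hl hw hl0 h).1
  have hσ0 : σ ≠ 0 := by rintro rfl; norm_num at hσ
  have hne : ∀ᶠ t in 𝓝[≠] t₀, l t ≠ 0 := by
    have := hl.differentiableAt.hasDerivAt
    exact this.eventually_ne (h0 ▸ hσ0)
  filter_upwards [hne, (eventually_second_deriv hl hw h).filter_mono nhdsWithin_le_nhds,
    h.filter_mono nhdsWithin_le_nhds,
    (eventually_ne_nhds ht₀).filter_mono nhdsWithin_le_nhds] with t hlt h2 h1 ht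
  refine ⟨ht, hlt, ?_⟩
  have hit : iteratedDeriv 2 l t = deriv (deriv l) t := by
    simp [iteratedDeriv_succ, iteratedDeriv_zero]
  obtain ⟨h1, h3⟩ := h1
  rw [hit]
  have hd : deriv l t = (σ * t + (1 - σ * χ₀) * l t + l t ^ 2 * w t) / t := by
    rw [eq_div_iff ht, mul_comm]; exact h1
  have hd' : deriv w t = (l t - l t * w t ^ 2 - (1 - σ * χ₀) * w t - χinf) / t := by
    rw [eq_div_iff ht, mul_comm]; exact h3
  have hdd : deriv (deriv l) t = (σ + (1 - σ * χ₀) * deriv l t +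
      (2 * l t * deriv l t * w t + l t ^ 2 * deriv w t) - deriv l t) / t := by
    rw [eq_div_iff ht]; linear_combination h2
  rw [hdd, hd', hd]
  field_simp
  linear_combination (t * χ₀ * l t - t ^ 2) * hσ

/-- The Painlevé equation cleared of denominators extends to `t₀`. -/
lemma IsVanishingPainleveThreePrimeSolution.eventually_polynomial {u : 𝕜 → 𝕜}
    (hu : IsVanishingPainleveThreePrimeSolution χ₀ χinf t₀ u) :
    ∀ᶠ t in 𝓝 t₀, t ^ 2 * (u t * deriv (deriv u) t - deriv u t ^ 2 + 1) + t * u t * deriv u t +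
      χinf * u t ^ 3 - u t ^ 4 - χ₀ * t * u t = 0 := by
  have ha := hu.analyticAt
  have ha' := ha.deriv
  have ha'' := ha.deriv.deriv
  have hA : AnalyticAt 𝕜 (fun t => t ^ 2 * (u t * deriv (deriv u) t - deriv u t ^ 2 + 1) +
      t * u t * deriv u t + χinf * u t ^ 3 - u t ^ 4 - χ₀ * t * u t) t₀ := by fun_prop
  refine (hA.frequently_zero_iff_eventually_zero).mp (Eventually.frequently ?_)
  filter_upwards [hu.equation] with t ht
  obtain ⟨ht, hut, h⟩ := ht
  have hit : iteratedDeriv 2 u t = deriv (deriv u) t := by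
    simp [iteratedDeriv_succ, iteratedDeriv_zero]
  rw [hit] at h
  rw [h]
  field_simp
  ring

lemma IsVanishingPainleveThreePrimeSolution.deriv_sq {u : 𝕜 → 𝕜} (ht₀ : t₀ ≠ 0)
    (hu : IsVanishingPainleveThreePrimeSolution χ₀ χinf t₀ u) : deriv u t₀ ^ 2 = 1 := by
  have h := hu.eventually_polynomial.self_of_nhds
  rw [hu.vanishes] at h
  refine mul_left_cancel₀ (pow_ne_zero 2 ht₀) ?_
  linear_combination -h

lemma IsVanishingPainleveThreePrimeSolution.mul_deriv_deriv {u : 𝕜 → 𝕜} (ht₀ : t₀ ≠ 0)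
    (hu : IsVanishingPainleveThreePrimeSolution χ₀ χinf t₀ u) :
    t₀ * deriv (deriv u) t₀ = deriv u t₀ - χ₀ := by
  have hE : (fun t => t ^ 2 * (u t * deriv (deriv u) t - deriv u t ^ 2 + 1) +
      t * u t * deriv u t + χinf * u t ^ 3 - u t ^ 4 - χ₀ * t * u t) =ᶠ[𝓝 t₀] fun _ => 0 :=
    hu.eventually_polynomial
  have hsq := hu.deriv_sq ht₀
  have d0 := hu.analyticAt.differentiableAt.hasDerivAt
  have d1 := hu.analyticAt.deriv.differentiableAt.hasDerivAt
  have d2 := hu.analyticAt.deriv.deriv.differentiableAt.hasDerivAt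
  have hid := hasDerivAt_id' t₀
  -- The derivative at `t₀`; the terms in `u'''` drop out because `u t₀ = 0`.
  have e := (((((hid.pow 2).mul (((d0.mul d2).sub (d1.pow 2)).add_const 1)).add
    ((hid.mul d0).mul d1)).add ((d0.pow 3).const_mul χinf)).sub (d0.pow 4)).sub
    ((hid.const_mul χ₀).mul d0) |>.deriv
  have e' := e.symm.trans (hE.deriv_eq.trans (deriv_const _ _))
  simp only [Pi.pow_apply, Pi.mul_apply, Pi.sub_apply, hu.vanishes] at e'
  norm_num [hsq] at e'
  have hne : t₀ * deriv u t₀ ≠ 0 := mul_ne_zero ht₀ (by rintro h; norm_num [h] at hsq)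
  refine mul_left_cancel₀ hne ?_
  linear_combination -e'

/-- Every solution of the Painlevé equation vanishing at `t₀` comes from an analytic solution of
the regular system: `w = (t u' - σ t - μ u) / u²` has a removable singularity at `t₀`. -/
lemma IsVanishingPainleveThreePrimeSolution.exists_regularSystem {u : 𝕜 → 𝕜} (ht₀ : t₀ ≠ 0)
    (hu : IsVanishingPainleveThreePrimeSolution χ₀ χinf t₀ u) (hσ : deriv u t₀ = σ) :
    ∃ w : 𝕜 → 𝕜, AnalyticAt 𝕜 w t₀ ∧
      ∀ᶠ t in 𝓝 t₀, RegularSystemAt σ (1 - σ * χ₀) χinf u w t := by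
  have ha := hu.analyticAt
  have ha' := ha.deriv
  have hsq : σ ^ 2 = 1 := hσ ▸ hu.deriv_sq ht₀
  have hσ0 : σ ≠ 0 := by rintro rfl; norm_num at hsq
  have h2 := hu.mul_deriv_deriv ht₀
  rw [hσ] at h2
  set N : 𝕜 → 𝕜 := fun t => t * deriv u t - σ * t - (1 - σ * χ₀) * u t with hN
  have hNa : AnalyticAt 𝕜 N t₀ := by fun_prop
  -- The numerator vanishes to second order, because of the value of the second derivative.
  have hN0 : N t₀ = 0 := by simp only [hN, hu.vanishes, hσ]; ring
  have hN1 : deriv N t₀ = 0 := by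
    have := (((hasDerivAt_id' t₀).mul ha'.differentiableAt.hasDerivAt).sub
      ((hasDerivAt_id' t₀).const_mul σ)).sub
      (ha.differentiableAt.hasDerivAt.const_mul (1 - σ * χ₀)) |>.deriv
    refine this.trans ?_
    rw [hσ]
    linear_combination h2 + χ₀ * hsq
  have hord : ((2 : ℕ) : ℕ∞) ≤ analyticOrderAt N t₀ := by
    rw [natCast_le_analyticOrderAt_iff_iteratedDeriv_eq_zero hNa]
    intro i hi
    interval_cases i
    · simpa using hN0
    · simpa using hN1
  obtain ⟨h, hha, hNh⟩ := (natCast_le_analyticOrderAt hNa).mp hord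
  have hord' : analyticOrderAt u t₀ = ((1 : ℕ) : ℕ∞) := by
    simpa using ha.analyticOrderAt_eq_one_of_zero_deriv_ne_zero hu.vanishes (hσ ▸ hσ0)
  obtain ⟨g, hga, hg0, hug⟩ := ha.analyticOrderAt_eq_natCast.mp hord'
  set w : 𝕜 → 𝕜 := fun t => h t / g t ^ 2 with hw
  have hwa : AnalyticAt 𝕜 w t₀ := hha.div (hga.pow 2) (pow_ne_zero 2 hg0)
  have hwa' := hwa.deriv
  have first : (fun t => u t ^ 2 * w t) =ᶠ[𝓝 t₀] N := by
    filter_upwards [hNh, hug, hga.continuousAt.eventually_ne hg0] with t h1 h2 h3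
    rw [h1, h2, hw]
    simp only [smul_eq_mul, pow_one]
    field_simp
  refine ⟨w, hwa, ?_⟩
  have second : ∀ᶠ t in 𝓝 t₀,
      t * deriv w t - (u t - u t * w t ^ 2 - (1 - σ * χ₀) * w t - χinf) = 0 := by
    have hA : AnalyticAt 𝕜 (fun t => t * deriv w t -
      (u t - u t * w t ^ 2 - (1 - σ * χ₀) * w t - χinf)) t₀ := by fun_prop
    refine (hA.frequently_zero_iff_eventually_zero).mp (Eventually.frequently ?_)
    have hP := hu.eventually_polynomial
    filter_upwards [hu.equation, first.filter_mono nhdsWithin_le_nhds,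
      first.deriv.filter_mono nhdsWithin_le_nhds, hP.filter_mono nhdsWithin_le_nhds,
      (eventually_hasDerivAt ha).filter_mono nhdsWithin_le_nhds,
      (eventually_hasDerivAt ha').filter_mono nhdsWithin_le_nhds,
      (eventually_hasDerivAt hwa).filter_mono nhdsWithin_le_nhds] with t ht h1 h1' hPt d0 d1 dw
    have e1 := ((d0.pow 2).mul dw).deriv
    have e2 := (((hasDerivAt_id' t).mul d1).sub ((hasDerivAt_id' t).const_mul σ)).sub
      (d0.const_mul (1 - σ * χ₀)) |>.deriv
    have e3 := e1.symm.trans (h1'.trans e2)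
    simp only [Pi.pow_apply] at e3
    norm_num at e3
    simp only [hN] at h1
    -- Off `t₀` it suffices to check the equation multiplied by `u³`, where `t u' = σ t + μ u + u² w`
    -- and its derivative eliminate `u'` and `u''` from the Painlevé equation.
    refine (mul_eq_zero.mp ?_).resolve_left (pow_ne_zero 3 ht.2.1)
    linear_combination u t * t * e3 + hPt - (t * deriv u t + (σ * t + (1 - σ * χ₀) * u t +
      u t ^ 2 * w t) - (1 - σ * χ₀) * u t - 2 * u t ^ 2 * w t) * h1 +
      (t ^ 2 - t * u t * χ₀) * hsq
  filter_upwards [first, second] with t h1 h2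
  simp only [hN] at h1
  exact ⟨by linear_combination -h1, by linear_combination h2⟩

end Painleve

theorem theorem2 {𝕜 : Type*} [RCLike 𝕜] (χ₀ χinf t₀ : 𝕜) (ht₀ : t₀ ≠ 0) :
    -- both families exist, with arbitrary third derivative
    (∀ σ : 𝕜, (σ = 1 ∨ σ = -1) → ∀ c : 𝕜, ∃ u : 𝕜 → 𝕜,
      IsVanishingPainleveThreePrimeSolution χ₀ χinf t₀ u ∧
        deriv u t₀ = σ ∧ iteratedDeriv 3 u t₀ = c) ∧
    -- every solution lies in one of them, and its second derivative is determined
    (∀ u : 𝕜 → 𝕜, IsVanishingPainleveThreePrimeSolution χ₀ χinf t₀ u →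
      (deriv u t₀ = 1 ∨ deriv u t₀ = -1) ∧
        iteratedDeriv 2 u t₀ = (deriv u t₀ - χ₀) / t₀) ∧
    -- within a family the third derivative identifies the solution near `t₀`
    (∀ u v : 𝕜 → 𝕜, IsVanishingPainleveThreePrimeSolution χ₀ χinf t₀ u →
      IsVanishingPainleveThreePrimeSolution χ₀ χinf t₀ v →
      deriv u t₀ = deriv v t₀ → iteratedDeriv 3 u t₀ = iteratedDeriv 3 v t₀ →
        u =ᶠ[𝓝 t₀] v) := by
  refine ⟨fun σ hσ c => ?_, fun u hu => ⟨?_, ?_⟩, fun u v hu hv h1 h3 => ?_⟩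
  · have hsq : σ ^ 2 = 1 := sq_eq_one_iff.mpr hσ
    -- The value of `w` at `t₀` that produces the third derivative `c`.
    obtain ⟨l, w, hl, hw, hl0, hw0, h⟩ := exists_analytic_regularSystem σ (1 - σ * χ₀) χinf 0
      ((t₀ * c - (-1 - σ * χ₀) * ((σ - χ₀) / t₀)) / 2) ht₀
    obtain ⟨h1, h3⟩ := deriv_and_third_deriv_of_regularSystem ht₀ hsq hl hw hl0 h
    refine ⟨l, isVanishing_of_regularSystem ht₀ hsq hl hw hl0 h, h1, mul_left_cancel₀ ht₀ ?_⟩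
    rw [h3, hw0]
    ring
  · exact sq_eq_one_iff.mp (hu.deriv_sq ht₀)
  · have hit : iteratedDeriv 2 u t₀ = deriv (deriv u) t₀ := by
      simp [iteratedDeriv_succ, iteratedDeriv_zero]
    rw [hit, eq_div_iff ht₀, mul_comm]
    exact hu.mul_deriv_deriv ht₀
  · have hsq := hu.deriv_sq ht₀
    obtain ⟨w, hw, h⟩ := hu.exists_regularSystem ht₀ rfl
    obtain ⟨w', hw', h'⟩ := hv.exists_regularSystem ht₀ h1.symm
    have hu3 := (deriv_and_third_deriv_of_regularSystem ht₀ hsq hu.analyticAt hw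
      hu.vanishes h).2
    have hv3 := (deriv_and_third_deriv_of_regularSystem ht₀ hsq hv.analyticAt hw'
      hv.vanishes h').2
    refine regularSystem_unique ht₀ hu.analyticAt hw hv.analyticAt hw' h h'
      (hu.vanishes.trans hv.vanishes.symm) (mul_left_cancel₀ (two_ne_zero (α := 𝕜)) ?_)
    rw [h3] at hu3
    linear_combination hv3 - hu3
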